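/- Let $E$ be a real Banach lattice, and let $E^{*}$ be its norm dual, which is a Banach lattice for the order $f\le g\iff f(x)\le g(x)$ for all $x\ge 0$ in $E$. Suppose that $E$ has the weak Dunford–Pettis* (wDP*) property: $f_n(x_n)\to 0$ for every weakly null sequence $(x_n)$ in $E$ and every weak* null sequence $(f_n)$ in $E^{*}$ with pairwise disjoint terms (that is, $|f_n|\wedge|f_m|=0$ for $n\ne m$). If the norms of $E$ and of $E^{*}$ are both order continuous (that is, every decreasing net with infimum $0$ converges to $0$ in norm), then $E$ is finite dimensional. In particular, every reflexive Banach lattice with the wDP* property is finite dimensional. -/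

import Mathlib

open Filter Topology

/-! ### The dual of a Banach lattice, as a lattice -/

section DualLattice

set_option linter.unusedSectionVars false

variable {E : Type*} [NormedAddCommGroup E] [NormedSpace ℝ E] [Lattice E]
  [IsOrderedAddMonoid E] [IsOrderedModule ℝ E] [HasSolidNorm E]

namespace DualLattice

/-- The value `sup {f y | 0 ≤ y ≤ x}` of the positive part of `f` at a positive element `x`. -/
noncomputable def posVal (f : StrongDual ℝ E) (x : E) : ℝ :=
  sSup (f '' Set.Icc 0 x)

theorem apply_le_norm (f : StrongDual ℝ E) {x y : E} (hy : y ∈ Set.Icc 0 x) :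
    f y ≤ ‖f‖ * ‖x‖ := by
  have h1 : ‖y‖ ≤ ‖x‖ := by
    apply norm_le_norm_of_abs_le_abs
    rw [abs_of_nonneg hy.1, abs_of_nonneg (hy.1.trans hy.2)]
    exact hy.2
  calc f y ≤ ‖f y‖ := le_abs_self _
    _ ≤ ‖f‖ * ‖y‖ := f.le_opNorm y
    _ ≤ ‖f‖ * ‖x‖ := by gcongr

theorem bddAbove_image (f : StrongDual ℝ E) (x : E) : BddAbove (f '' Set.Icc 0 x) :=
  ⟨‖f‖ * ‖x‖, by rintro _ ⟨y, hy, rfl⟩; exact apply_le_norm f hy⟩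

theorem le_posVal (f : StrongDual ℝ E) {x y : E} (h0 : 0 ≤ y) (hy : y ≤ x) : f y ≤ posVal f x :=
  le_csSup (bddAbove_image f x) ⟨y, ⟨h0, hy⟩, rfl⟩

theorem posVal_le {f : StrongDual ℝ E} {x : E} {c : ℝ} (hx : 0 ≤ x)
    (h : ∀ y, 0 ≤ y → y ≤ x → f y ≤ c) : posVal f x ≤ c :=
  csSup_le ⟨f 0, 0, ⟨le_rfl, hx⟩, rfl⟩ (by rintro _ ⟨y, hy, rfl⟩; exact h y hy.1 hy.2)

theorem posVal_nonneg (f : StrongDual ℝ E) {x : E} (hx : 0 ≤ x) : 0 ≤ posVal f x := by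
  simpa using le_posVal f le_rfl hx

theorem posVal_le_norm (f : StrongDual ℝ E) {x : E} (hx : 0 ≤ x) : posVal f x ≤ ‖f‖ * ‖x‖ :=
  posVal_le hx fun _ h0 hy => apply_le_norm f ⟨h0, hy⟩

theorem posVal_add (f : StrongDual ℝ E) {a b : E} (ha : 0 ≤ a) (hb : 0 ≤ b) :
    posVal f (a + b) = posVal f a + posVal f b := by
  apply le_antisymm
  · refine posVal_le (add_nonneg ha hb) fun y h0 hy => ?_
    have h1 : f y = f (y ⊓ a) + f (y - y ⊓ a) := by simp
    rw [h1]
    refine add_le_add (le_posVal f (le_inf h0 ha) inf_le_right)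
      (le_posVal f (sub_nonneg.2 inf_le_left) ?_)
    rw [sub_le_comm]
    exact le_inf (sub_le_self _ hb) (sub_le_iff_le_add.2 hy)
  · rw [← le_sub_iff_add_le]
    refine posVal_le ha fun y h0 hy => ?_
    rw [le_sub_comm]
    refine posVal_le hb fun z z0 hz => ?_
    rw [le_sub_iff_add_le, add_comm, ← map_add]
    exact le_posVal f (add_nonneg h0 z0) (add_le_add hy hz)

theorem mul_posVal_le (f : StrongDual ℝ E) {c : ℝ} (hc : 0 < c) {x : E} (hx : 0 ≤ x) :
    c * posVal f x ≤ posVal f (c • x) := by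
  rw [← le_div_iff₀' hc]
  refine posVal_le hx fun y h0 hy => ?_
  rw [le_div_iff₀' hc, ← smul_eq_mul, ← map_smul]
  exact le_posVal f (smul_nonneg hc.le h0) (smul_le_smul_of_nonneg_left hy hc.le)

theorem posVal_zero (f : StrongDual ℝ E) : posVal f 0 = 0 := by
  simp [posVal]

theorem posVal_smul (f : StrongDual ℝ E) {c : ℝ} (hc : 0 ≤ c) {x : E} (hx : 0 ≤ x) :
    posVal f (c • x) = c * posVal f x := by
  rcases hc.eq_or_lt with rfl | hc
  · simp [posVal_zero]
  · refine le_antisymm ?_ (mul_posVal_le f hc hx)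
    have h := mul_posVal_le f (inv_pos.2 hc) (smul_nonneg hc.le hx)
    rw [inv_smul_smul₀ hc.ne'] at h
    rwa [inv_mul_le_iff₀ hc] at h

theorem posVal_sub_eq (f : StrongDual ℝ E) {a b : E} (ha : 0 ≤ a) (hb : 0 ≤ b) :
    posVal f (a - b)⁺ - posVal f (a - b)⁻ = posVal f a - posVal f b := by
  have h : (a - b)⁺ + b = a + (a - b)⁻ := by
    have := posPart_sub_negPart (a - b)
    rw [sub_eq_sub_iff_add_eq_add] at this
    exact this
  have h2 := posVal_add f (posPart_nonneg (a - b)) hb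
  rw [h, posVal_add f ha (negPart_nonneg (a - b))] at h2
  linarith

/-- The positive part of a continuous functional: the continuous functional whose value at
`x ≥ 0` is `sup {f y | 0 ≤ y ≤ x}`. -/
noncomputable def pos (f : StrongDual ℝ E) : StrongDual ℝ E :=
  LinearMap.mkContinuous
    { toFun := fun x => posVal f x⁺ - posVal f x⁻
      map_add' := fun x y => by
        have h : x + y = (x⁺ + y⁺) - (x⁻ + y⁻) := by
          rw [add_sub_add_comm, posPart_sub_negPart, posPart_sub_negPart]
        have hx := posPart_nonneg x
        have hy := posPart_nonneg y
        have hx' := negPart_nonneg x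
        have hy' := negPart_nonneg y
        rw [h, posVal_sub_eq f (add_nonneg hx hy) (add_nonneg hx' hy'),
          posVal_add f hx hy, posVal_add f hx' hy']
        ring
      map_smul' := fun c x => by
        have hx := posPart_nonneg x
        have hx' := negPart_nonneg x
        rcases le_total 0 c with hc | hc
        · have h : c • x = c • x⁺ - c • x⁻ := by rw [← smul_sub, posPart_sub_negPart]
          rw [h, posVal_sub_eq f (smul_nonneg hc hx) (smul_nonneg hc hx'),
            posVal_smul f hc hx, posVal_smul f hc hx']
          simp [mul_sub]
        · have hc' : 0 ≤ -c := neg_nonneg.2 hc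
          have h : c • x = (-c) • x⁻ - (-c) • x⁺ := by
            rw [← smul_sub, neg_smul, ← smul_neg, neg_sub, posPart_sub_negPart]
          rw [h, posVal_sub_eq f (smul_nonneg hc' hx') (smul_nonneg hc' hx),
            posVal_smul f hc' hx, posVal_smul f hc' hx']
          simp only [RingHom.id_apply, smul_eq_mul]
          ring }
    ‖f‖ (fun x => by
      have hp := posVal_nonneg f (posPart_nonneg x)
      have hn := posVal_nonneg f (negPart_nonneg x)
      have key : ∀ y : E, 0 ≤ y → y ≤ |x| → posVal f y ≤ ‖f‖ * ‖x‖ := fun y h0 hy => by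
        refine (posVal_le_norm f h0).trans ?_
        gcongr
        apply norm_le_norm_of_abs_le_abs
        rwa [abs_of_nonneg h0]
      have hp' := key x⁺ (posPart_nonneg x) (sup_le (le_abs_self x) (abs_nonneg x))
      have hn' := key x⁻ (negPart_nonneg x) (sup_le (neg_le_abs x) (abs_nonneg x))
      change |posVal f x⁺ - posVal f x⁻| ≤ _
      rw [abs_le]
      constructor <;> linarith)

theorem pos_apply (f : StrongDual ℝ E) {x : E} (hx : 0 ≤ x) : pos f x = posVal f x := by
  change posVal f x⁺ - posVal f x⁻ = _
  rw [posPart_of_nonneg hx, negPart_of_nonneg hx, posVal_zero, sub_zero]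

end DualLattice

open DualLattice in
/-- The dual `E*` of a normed lattice with its usual order, `f ≤ g` iff `f x ≤ g x` for all
`x ≥ 0`; this order is a lattice order. -/
noncomputable instance instLatticeStrongDual : Lattice (StrongDual ℝ E) where
  le f g := ∀ x : E, 0 ≤ x → f x ≤ g x
  le_refl f x _ := le_rfl
  le_trans f g h hfg hgh x hx := (hfg x hx).trans (hgh x hx)
  le_antisymm f g hfg hgf := by
    have key : ∀ x : E, 0 ≤ x → f x = g x := fun x hx => le_antisymm (hfg x hx) (hgf x hx)
    ext x
    rw [← posPart_sub_negPart x, map_sub, map_sub, key _ (posPart_nonneg x),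
      key _ (negPart_nonneg x)]
  sup f g := g + pos (f - g)
  le_sup_left f g x hx := by
    have h := le_posVal (f - g) hx le_rfl
    simp only [sub_apply] at h
    simp only [add_apply, pos_apply _ hx]
    linarith
  le_sup_right f g x hx := by
    have h := posVal_nonneg (f - g) hx
    simp only [add_apply, pos_apply _ hx]
    linarith
  sup_le f g h hf hg x hx := by
    have key : posVal (f - g) x ≤ h x - g x := by
      refine posVal_le hx fun y h0 hy => ?_
      have h1 := hf y h0
      have h2 := hg (x - y) (sub_nonneg.2 hy)
      simp only [map_sub] at h2
      simp only [sub_apply]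
      linarith
    simp only [add_apply, pos_apply _ hx]
    linarith
  inf f g := f - pos (f - g)
  inf_le_left f g x hx := by
    have h := posVal_nonneg (f - g) hx
    simp only [sub_apply, pos_apply _ hx]
    linarith
  inf_le_right f g x hx := by
    have h := le_posVal (f - g) hx le_rfl
    simp only [sub_apply] at h
    simp only [sub_apply, pos_apply _ hx]
    linarith
  le_inf h f g hf hg x hx := by
    have key : posVal (f - g) x ≤ f x - h x := by
      refine posVal_le hx fun y h0 hy => ?_
      have h1 := hg y h0
      have h2 := hf (x - y) (sub_nonneg.2 hy)
      simp only [map_sub] at h2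
      simp only [sub_apply]
      linarith
    simp only [sub_apply, pos_apply _ hx]
    linarith

end DualLattice

/-! ### The properties of Banach lattices in the statement -/

/-- The norm is order continuous: every decreasing net with infimum `0` converges to `0` in norm.
(Index sets in the universe of `X` suffice, since the range of a net is a subset of `X`.) -/
def HasOrderContinuousNorm.{u} (X : Type u) [NormedAddCommGroup X] [PartialOrder X] : Prop :=
  ∀ (ι : Type u) [Preorder ι] [IsDirectedOrder ι] [Nonempty ι] (x : ι → X),
    Antitone x → IsGLB (Set.range x) 0 → Tendsto (fun i => ‖x i‖) atTop (𝓝 0)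

section Sequences

variable {E : Type*} [NormedAddCommGroup E] [NormedSpace ℝ E]

/-- `x n → 0` in the weak topology of `E`. -/
def IsWeaklyNull (x : ℕ → E) : Prop :=
  Tendsto (fun n => toWeakSpace ℝ E (x n)) atTop (𝓝 0)

/-- `f n → 0` in the weak* topology of the dual `E*`. -/
def IsWeakStarNull (f : ℕ → StrongDual ℝ E) : Prop :=
  Tendsto (fun n => StrongDual.toWeakDual (f n)) atTop (𝓝 0)

end Sequences

/-- The terms of the sequence are pairwise disjoint: `|f n| ⊓ |f m| = 0` for `n ≠ m`. -/
def IsDisjointSeq {X : Type*} [AddCommGroup X] [Lattice X] (f : ℕ → X) : Prop :=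
  ∀ n m : ℕ, n ≠ m → |f n| ⊓ |f m| = 0

/-- The weak Dunford-Pettis* property. -/
def HasWDPStarProperty (E : Type*) [NormedAddCommGroup E] [NormedSpace ℝ E] [Lattice E]
    [IsOrderedAddMonoid E] [IsOrderedModule ℝ E] [HasSolidNorm E] : Prop :=
  ∀ (x : ℕ → E) (f : ℕ → StrongDual ℝ E), IsWeaklyNull x → IsDisjointSeq f →
    IsWeakStarNull f → Tendsto (fun n => f n (x n)) atTop (𝓝 0)

/-- The normed space `X` is reflexive: the canonical embedding into the topological bidual
is onto. -/
def IsReflexiveSpace (X : Type*) [NormedAddCommGroup X] [NormedSpace ℝ X] : Prop :=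
  Function.Surjective (NormedSpace.inclusionInDoubleDual ℝ X)

section BanachLattice

set_option linter.unusedSectionVars false

variable {E : Type*} [NormedAddCommGroup E] [NormedSpace ℝ E] [Lattice E]
  [IsOrderedAddMonoid E] [IsOrderedModule ℝ E] [HasSolidNorm E]

/-! ### Elementary facts on disjointness -/

/-! If `E` is infinite dimensional, it contains a disjoint sequence of positive unit vectors `x n`.
Let `g n ≥ 0` norm `x n`, and let `f n` be the component of `g n` carried by `x n`, that is `f n y =
lim g n (y ⊓ t • x n)` as `t → ∞`, for `y ≥ 0`. Then `f n (x n) = g n (x n) ≥ 1`, and the `f n` are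
pairwise disjoint (`IsComponent.inf_eq_zero`). Order continuity of the dual norm makes `x n` weakly
null (`tendsto_apply_of_disjoint`), and order continuity of the norm of `E` makes `f n` weak* null
(`tendsto_component_apply`). This contradicts the wDP* property. Both convergences rest on
`HasOrderContinuousNorm.exists_upperBound_norm_sub_lt`, applied to the partial sums of a disjoint
sequence or of components. In the reflexive case both norms are order continuous by a Dini argument:
a decreasing positive net that is weakly null is norm null. -/

theorem add_inf_le_inf_add_inf {α : Type*} [AddCommGroup α] [Lattice α] [IsOrderedAddMonoid α]
    {a b c : α} (ha : 0 ≤ a) (hb : 0 ≤ b) (hc : 0 ≤ c) : (a + b) ⊓ c ≤ a ⊓ c + b ⊓ c := by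
  rw [add_inf, inf_add, inf_add]
  refine le_inf (le_inf inf_le_left (inf_le_right.trans ?_))
    (le_inf (inf_le_right.trans ?_) (inf_le_right.trans ?_))
  · exact le_add_of_nonneg_right hb
  · exact le_add_of_nonneg_left ha
  · exact le_add_of_nonneg_left hc

theorem sum_inf_eq_zero {α ι : Type*} [AddCommGroup α] [Lattice α] [IsOrderedAddMonoid α]
    {y : ι → α} (h0 : ∀ i, 0 ≤ y i) {c : α} (hc : 0 ≤ c) (s : Finset ι)
    (h : ∀ i ∈ s, y i ⊓ c = 0) : (∑ i ∈ s, y i) ⊓ c = 0 := by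
  classical
  induction s using Finset.induction_on with
  | empty => simpa using hc
  | insert a s ha ih =>
    rw [Finset.sum_insert ha]
    refine le_antisymm ?_ (le_inf (add_nonneg (h0 a) (Finset.sum_nonneg fun i _ => h0 i)) hc)
    refine (add_inf_le_inf_add_inf (h0 a) (Finset.sum_nonneg fun i _ => h0 i) hc).trans ?_
    rw [h a (Finset.mem_insert_self a s), ih fun i hi => h i (Finset.mem_insert_of_mem hi),
      add_zero]

/-- For disjoint elements the sum is the supremum, since `a + b = a ⊓ b + a ⊔ b`. -/
theorem sum_le_of_disjoint {α ι : Type*} [AddCommGroup α] [Lattice α] [IsOrderedAddMonoid α]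
    {y : ι → α} (h0 : ∀ i, 0 ≤ y i) (hd : Pairwise fun i j => y i ⊓ y j = 0) {x : α}
    (hx : 0 ≤ x) (h : ∀ i, y i ≤ x) (s : Finset ι) : ∑ i ∈ s, y i ≤ x := by
  classical
  induction s using Finset.induction_on with
  | empty => simpa using hx
  | insert a s ha ih =>
    have h1 : (∑ i ∈ s, y i) ⊓ y a = 0 :=
      sum_inf_eq_zero h0 (h0 a) s fun i hi => hd (ne_of_mem_of_not_mem hi ha)
    rw [Finset.sum_insert ha, add_comm, ← inf_add_sup, h1, zero_add]
    exact sup_le ih (h a)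

theorem smul_inf_of_pos {c : ℝ} (hc : 0 < c) (a b : E) : c • (a ⊓ b) = (c • a) ⊓ (c • b) :=
  map_inf (OrderIso.smulRight hc : E ≃o E) a b

theorem smul_inf_smul_eq_zero {a b : E} (ha : 0 ≤ a) (hb : 0 ≤ b) (h : a ⊓ b = 0) {s t : ℝ}
    (hs : 0 ≤ s) (ht : 0 ≤ t) : (s • a) ⊓ (t • b) = 0 := by
  refine le_antisymm ?_ (le_inf (smul_nonneg hs ha) (smul_nonneg ht hb))
  -- The extra `1` keeps the common factor strictly positive, so that scaling by it is an order
  -- isomorphism.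
  have hM : 0 < max s t + 1 := by positivity
  calc (s • a) ⊓ (t • b) ≤ ((max s t + 1) • a) ⊓ ((max s t + 1) • b) := by
        refine inf_le_inf (smul_le_smul_of_nonneg_right ?_ ha)
          (smul_le_smul_of_nonneg_right ?_ hb)
        · linarith [le_max_left s t]
        · linarith [le_max_right s t]
    _ = 0 := by rw [← smul_inf_of_pos hM, h, smul_zero]

theorem inf_smul_eq_zero {a b : E} (ha : 0 ≤ a) (hb : 0 ≤ b) (h : a ⊓ b = 0) {t : ℝ}
    (ht : 0 ≤ t) : a ⊓ (t • b) = 0 := by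
  simpa using smul_inf_smul_eq_zero ha hb h zero_le_one ht

theorem inf_eq_zero_of_le {α : Type*} [Lattice α] [Zero α] {a b c d : α} (ha : 0 ≤ a) (hb : 0 ≤ b)
    (hac : a ≤ c) (hbd : b ≤ d) (h : c ⊓ d = 0) : a ⊓ b = 0 :=
  le_antisymm ((inf_le_inf hac hbd).trans h.le) (le_inf ha hb)

/-! ### The order on the dual -/

theorem StrongDual.le_iff {f g : StrongDual ℝ E} : f ≤ g ↔ ∀ x : E, 0 ≤ x → f x ≤ g x := Iff.rfl

theorem StrongDual.nonneg_iff {f : StrongDual ℝ E} : 0 ≤ f ↔ ∀ x : E, 0 ≤ x → 0 ≤ f x := Iff.rfl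

instance StrongDual.instIsOrderedAddMonoid : IsOrderedAddMonoid (StrongDual ℝ E) where
  add_le_add_left f g h k x hx := by
    have := h x hx
    simp only [add_apply]
    linarith

theorem StrongDual.apply_mono {f : StrongDual ℝ E} (hf : 0 ≤ f) {x y : E} (h : x ≤ y) :
    f x ≤ f y := by
  have := StrongDual.nonneg_iff.1 hf (y - x) (sub_nonneg.2 h)
  rw [map_sub] at this
  linarith

theorem StrongDual.pos_nonneg (f : StrongDual ℝ E) : 0 ≤ DualLattice.pos f := fun x hx => by
  rw [DualLattice.pos_apply f hx]
  exact DualLattice.posVal_nonneg f hx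

theorem StrongDual.le_pos (f : StrongDual ℝ E) : f ≤ DualLattice.pos f := fun x hx => by
  rw [DualLattice.pos_apply f hx]
  exact DualLattice.le_posVal f hx le_rfl

theorem StrongDual.exists_nonneg_sub_nonneg (f : StrongDual ℝ E) :
    ∃ g h : StrongDual ℝ E, 0 ≤ g ∧ 0 ≤ h ∧ f = g - h :=
  ⟨DualLattice.pos f, DualLattice.pos f - f, StrongDual.pos_nonneg f,
    sub_nonneg.2 (StrongDual.le_pos f), by abel⟩

/-- Every positive `u` is normed by a positive functional. -/
theorem exists_nonneg_dual_vector {u : E} (hu : 0 ≤ u) :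
    ∃ g : StrongDual ℝ E, 0 ≤ g ∧ ‖u‖ ≤ g u ∧ ∀ x, 0 ≤ x → g x ≤ ‖x‖ := by
  obtain ⟨g, hg, hgu⟩ := exists_dual_vector'' ℝ u
  refine ⟨DualLattice.pos g, StrongDual.pos_nonneg g, ?_, fun x hx => ?_⟩
  · have := StrongDual.le_pos g u hu
    rw [hgu] at this
    exact this
  · rw [DualLattice.pos_apply g hx]
    refine (DualLattice.posVal_le_norm g hx).trans ?_
    exact mul_le_of_le_one_left (norm_nonneg x) hg

/-- A bounded additive function on the positive cone extends to a continuous functional. -/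
theorem exists_strongDual_of_additive {p : E → ℝ} {C : ℝ}
    (hadd : ∀ x y, 0 ≤ x → 0 ≤ y → p (x + y) = p x + p y)
    (h0 : ∀ x, 0 ≤ x → 0 ≤ p x) (hC : ∀ x, 0 ≤ x → p x ≤ C * ‖x‖) :
    ∃ f : StrongDual ℝ E, ∀ x, 0 ≤ x → f x = p x := by
  have hp0 : p 0 = 0 := by simpa using hadd 0 0 le_rfl le_rfl
  let F : E →+ ℝ :=
    { toFun := fun x => p x⁺ - p x⁻
      map_zero' := by simp
      map_add' := fun x y => by
        have h : (x + y)⁺ + (x⁻ + y⁻) = (x⁺ + y⁺) + (x + y)⁻ := by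
          rw [← sub_eq_sub_iff_add_eq_add, posPart_sub_negPart, add_sub_add_comm,
            posPart_sub_negPart, posPart_sub_negPart]
        have hp := posPart_nonneg (α := E)
        have hn := negPart_nonneg (α := E)
        have h2 := congrArg p h
        rw [hadd _ _ (hp _) (add_nonneg (hn _) (hn _)), hadd _ _ (hn _) (hn _),
          hadd _ _ (add_nonneg (hp _) (hp _)) (hn _), hadd _ _ (hp _) (hp _)] at h2
        linarith }
  have hF : ∀ x, 0 ≤ x → F x = p x := fun x hx => by
    change p x⁺ - p x⁻ = p x
    rw [posPart_of_nonneg hx, negPart_of_nonneg hx, hp0, sub_zero]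
  have hbound : ∀ x, ‖F x‖ ≤ C * ‖x‖ := fun x => by
    have key : ∀ y : E, 0 ≤ y → y ≤ |x| → p y ≤ p |x| := fun y hy hyx => by
      have := hadd y (|x| - y) hy (sub_nonneg.2 hyx)
      rw [add_sub_cancel] at this
      linarith [h0 _ (sub_nonneg.2 hyx)]
    have h1 := key x⁺ (posPart_nonneg x) (sup_le (le_abs_self x) (abs_nonneg x))
    have h2 := key x⁻ (negPart_nonneg x) (sup_le (neg_le_abs x) (abs_nonneg x))
    have h3 := hC |x| (abs_nonneg x)
    rw [norm_abs_eq_norm] at h3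
    have h4 := h0 _ (posPart_nonneg x)
    have h5 := h0 _ (negPart_nonneg x)
    change |p x⁺ - p x⁻| ≤ _
    rw [abs_le]
    constructor <;> linarith
  refine ⟨F.toRealLinearMap (AddMonoidHomClass.continuous_of_bound F C hbound), fun x hx => ?_⟩
  exact hF x hx

/-! ### The component of a functional carried by an element -/

/-- `f` is the part of `g` carried by the principal band generated by `u`. -/
def IsComponent (g : StrongDual ℝ E) (u : E) (f : StrongDual ℝ E) : Prop :=
  ∀ x, 0 ≤ x → Tendsto (fun t : ℝ => g (x ⊓ t • u)) atTop (𝓝 (f x))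

/-- The values `g (x ⊓ t • u)` increase with `t` and are bounded by `g x`, so they converge to their
supremum. This limit is additive on the positive cone and therefore extends to a functional. -/
theorem exists_isComponent {g : StrongDual ℝ E} (hg : 0 ≤ g) {u : E} (hu : 0 ≤ u) :
    ∃ f, IsComponent g u f := by
  have hlim : ∀ x : E, Tendsto (fun t : ℝ => g (x ⊓ t • u)) atTop
      (𝓝 (⨆ t : ℝ, g (x ⊓ t • u))) := fun x => by
    refine tendsto_atTop_ciSup (fun s t hst => ?_) ⟨g x, ?_⟩
    · exact StrongDual.apply_mono hg (inf_le_inf_left x (smul_le_smul_of_nonneg_right hst hu))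
    · rintro _ ⟨t, rfl⟩
      exact StrongDual.apply_mono hg inf_le_left
  suffices h : ∃ f : StrongDual ℝ E, ∀ x, 0 ≤ x → f x = ⨆ t : ℝ, g (x ⊓ t • u) by
    obtain ⟨f, hf⟩ := h
    exact ⟨f, fun x hx => by rw [hf x hx]; exact hlim x⟩
  refine exists_strongDual_of_additive (p := fun x => ⨆ t : ℝ, g (x ⊓ t • u))
    (C := ‖g‖) (fun x y hx hy => ?_) (fun x hx => ?_) (fun x hx => ?_)
  · have h1 := (hlim x).add (hlim y)
    apply le_antisymm
    · refine le_of_tendsto_of_tendsto (hlim (x + y)) h1 ?_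
      filter_upwards [eventually_ge_atTop 0] with t ht
      rw [← map_add]
      exact StrongDual.apply_mono hg (add_inf_le_inf_add_inf hx hy (smul_nonneg ht hu))
    -- Superadditivity: `x ⊓ t • u + y ⊓ t • u` lies below `2t • u`, and doubling `t` does not
    -- change the limit.
    · have h2 : Tendsto (fun t : ℝ => g ((x + y) ⊓ (2 * t) • u)) atTop
          (𝓝 (⨆ t : ℝ, g ((x + y) ⊓ t • u))) :=
        (hlim (x + y)).comp (tendsto_id.const_mul_atTop two_pos)
      refine le_of_tendsto_of_tendsto' h1 h2 fun t => ?_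
      rw [← map_add]
      refine StrongDual.apply_mono hg (le_inf (add_le_add inf_le_left inf_le_left) ?_)
      rw [two_mul, add_smul]
      exact add_le_add inf_le_right inf_le_right
  · refine ge_of_tendsto (hlim x) ?_
    filter_upwards [eventually_ge_atTop 0] with t ht
    exact StrongDual.nonneg_iff.1 hg _ (le_inf hx (smul_nonneg ht hu))
  · refine le_of_tendsto' (hlim x) fun t => ?_
    refine (StrongDual.apply_mono hg inf_le_left).trans ((le_abs_self _).trans ?_)
    exact g.le_opNorm x

namespace IsComponent

variable {g f h k : StrongDual ℝ E} {u v x : E}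

theorem nonneg (hf : IsComponent g u f) (hg : 0 ≤ g) (hu : 0 ≤ u) : 0 ≤ f := fun x hx => by
  refine ge_of_tendsto (hf x hx) ?_
  filter_upwards [eventually_ge_atTop 0] with t ht
  exact StrongDual.nonneg_iff.1 hg _ (le_inf hx (smul_nonneg ht hu))

theorem apply_of_le (hf : IsComponent g u f) (hu : 0 ≤ u) (hx : 0 ≤ x) {s : ℝ} (h : x ≤ s • u) :
    f x = g x := by
  refine tendsto_nhds_unique (hf x hx) (tendsto_const_nhds.congr' ?_)
  filter_upwards [eventually_ge_atTop s] with t ht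
  rw [inf_eq_left.2 (h.trans (smul_le_smul_of_nonneg_right ht hu))]

theorem apply_self (hf : IsComponent g u f) (hu : 0 ≤ u) : f u = g u :=
  hf.apply_of_le hu hu (one_smul ℝ u).ge

theorem apply_eq_zero (hf : IsComponent g u f) (hu : 0 ≤ u) (hx : 0 ≤ x) (h : x ⊓ u = 0) :
    f x = 0 := by
  refine tendsto_nhds_unique (hf x hx) (tendsto_const_nhds.congr' ?_)
  filter_upwards [eventually_ge_atTop 0] with t ht
  rw [inf_smul_eq_zero hx hu h ht, map_zero]

/-- Split `x` into `x ⊓ t • u` and the rest. On the first piece, which is disjoint from `v`, `h`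
vanishes; on the rest, `f` takes the value `f x - g (x ⊓ t • u)`, which tends to `0`. -/
theorem inf_eq_zero (hf : IsComponent g u f) (hh : IsComponent k v h) (hg : 0 ≤ g) (hk : 0 ≤ k)
    (hu : 0 ≤ u) (hv : 0 ≤ v) (huv : u ⊓ v = 0) : f ⊓ h = 0 := by
  refine le_antisymm (fun x hx => ?_) (le_inf (hf.nonneg hg hu) (hh.nonneg hk hv))
  have hlim : Tendsto (fun t : ℝ => f x - g (x ⊓ t • u)) atTop (𝓝 0) := by
    simpa using (hf x hx).const_sub (f x)
  refine ge_of_tendsto hlim ?_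
  filter_upwards [eventually_ge_atTop 0] with t ht
  have h0 : 0 ≤ x ⊓ t • u := le_inf hx (smul_nonneg ht hu)
  have h1 : (f ⊓ h) (x - x ⊓ t • u) ≤ f (x - x ⊓ t • u) :=
    StrongDual.le_iff.1 inf_le_left _ (sub_nonneg.2 inf_le_left)
  have h2 : (f ⊓ h) (x ⊓ t • u) ≤ h (x ⊓ t • u) := StrongDual.le_iff.1 inf_le_right _ h0
  have h3 : h (x ⊓ t • u) = 0 := hh.apply_eq_zero hv h0 <| inf_eq_zero_of_le h0 hv inf_le_right
    le_rfl (by rw [inf_comm]; exact inf_smul_eq_zero hv hu (by rwa [inf_comm]) ht)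
  have h4 : f (x ⊓ t • u) = g (x ⊓ t • u) := hf.apply_of_le hu h0 inf_le_right
  rw [map_sub, map_sub, h4] at h1
  linarith

end IsComponent

/-- For fixed `t ≥ 0` the elements `x ⊓ t • u n` are disjoint and below `x`, hence so is their sum;
apply `g` and let `t → ∞`. This gives the order bound needed to use order continuity of the dual
norm. -/
theorem sum_component_le {g : StrongDual ℝ E} (hg : 0 ≤ g) {u : ℕ → E} (hu : ∀ n, 0 ≤ u n)
    (hd : Pairwise fun n m => u n ⊓ u m = 0) {f : ℕ → StrongDual ℝ E}
    (hf : ∀ n, IsComponent g (u n) (f n)) (s : Finset ℕ) : ∑ n ∈ s, f n ≤ g := fun x hx => by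
  have hlim : Tendsto (fun t : ℝ => ∑ n ∈ s, g (x ⊓ t • u n)) atTop (𝓝 (∑ n ∈ s, f n x)) :=
    tendsto_finsetSum s fun n _ => hf n x hx
  have hval : (∑ n ∈ s, f n) x = ∑ n ∈ s, f n x := by simp
  rw [hval]
  refine le_of_tendsto hlim ?_
  filter_upwards [eventually_ge_atTop 0] with t ht
  rw [← map_sum]
  have h0 : ∀ n, 0 ≤ x ⊓ t • u n := fun n => le_inf hx (smul_nonneg ht (hu n))
  exact StrongDual.apply_mono hg <| sum_le_of_disjoint h0 (fun n m hnm => inf_eq_zero_of_le (h0 n)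
    (h0 m) inf_le_right inf_le_right (smul_inf_smul_eq_zero (hu n) (hu m) (hd hnm) ht ht)) hx
    (fun n => inf_le_left) s

/-! ### Order continuous norms -/

/-- The upper bounds of a bounded increasing sequence come arbitrarily close to the sequence if
the norm is order continuous. -/
theorem HasOrderContinuousNorm.exists_upperBound_norm_sub_lt {X : Type*} [NormedAddCommGroup X]
    [Lattice X] [IsOrderedAddMonoid X] (hX : HasOrderContinuousNorm X)
    (harch : ∀ w z : X, (∀ n : ℕ, n • w ≤ z) → w ≤ 0) {s : ℕ → X} (hs : Monotone s)
    {b : X} (hb : ∀ n, s n ≤ b) {ε : ℝ} (hε : 0 < ε) :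
    ∃ z N, (∀ n, s n ≤ z) ∧ ‖z - s N‖ < ε := by
  -- The differences `z - s n`, with `z` decreasing through the upper bounds and `n` increasing,
  -- form a decreasing net. No supremum of `s` is needed.
  let U := {z : X // ∀ n, s n ≤ z}
  have : Nonempty U := ⟨⟨b, hb⟩⟩
  have : IsDirectedOrder (Uᵒᵈ × ℕ) := ⟨fun p q =>
    ⟨(OrderDual.toDual ⟨p.1.ofDual.1 ⊓ q.1.ofDual.1,
        fun n => le_inf (p.1.ofDual.2 n) (q.1.ofDual.2 n)⟩, max p.2 q.2),
      ⟨(inf_le_left : p.1.ofDual.1 ⊓ q.1.ofDual.1 ≤ _), le_max_left _ _⟩,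
      ⟨(inf_le_right : p.1.ofDual.1 ⊓ q.1.ofDual.1 ≤ _), le_max_right _ _⟩⟩⟩
  have hlim := hX (Uᵒᵈ × ℕ) (fun p => p.1.ofDual.1 - s p.2)
    (fun p q hpq => sub_le_sub hpq.1 (hs hpq.2)) ⟨?_, fun w hw => ?_⟩
  · obtain ⟨p, hp⟩ := (hlim.eventually (gt_mem_nhds hε)).exists
    exact ⟨p.1.ofDual.1, p.2, p.1.ofDual.2, hp⟩
  · rintro _ ⟨p, rfl⟩
    exact sub_nonneg.2 (p.1.ofDual.2 p.2)
  -- The infimum of the net is `0`: subtracting a lower bound `w` from an upper bound of `s` yields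
  -- another upper bound, so all `b - k • w` are upper bounds, and the Archimedean property gives `w
  -- ≤ 0`.
  · have hsub : ∀ z : X, (∀ n, s n ≤ z) → ∀ n, s n ≤ z - w := fun z hz n => by
      have : w ≤ z - s n := hw ⟨(OrderDual.toDual ⟨z, hz⟩, n), rfl⟩
      exact le_sub_comm.1 this
    have hk : ∀ k n : ℕ, s n ≤ b - k • w := fun k => by
      induction k with
      | zero => simpa using hb
      | succ k ih =>
        rw [succ_nsmul, ← sub_sub]
        exact hsub _ ih
    exact harch w (b - s 0) fun k => le_sub_comm.1 (hk k 0)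

/-- The order is closed, and `w ≤ z / (n + 1)` for all `n`. -/
theorem le_zero_of_forall_nsmul_le {w z : E} (h : ∀ n : ℕ, n • w ≤ z) : w ≤ 0 := by
  have hlim : Tendsto (fun n : ℕ => (1 / ((n : ℝ) + 1)) • z) atTop (𝓝 0) := by
    simpa using (tendsto_one_div_add_atTop_nhds_zero_nat (𝕜 := ℝ)).smul_const z
  refine ge_of_tendsto' hlim fun n => ?_
  have hn : (0 : ℝ) < (n : ℝ) + 1 := by positivity
  have h1 := smul_le_smul_of_nonneg_left (h (n + 1)) (one_div_pos.2 hn).le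
  rwa [← Nat.cast_smul_eq_nsmul ℝ, smul_smul, Nat.cast_add_one, one_div_mul_cancel hn.ne',
    one_smul] at h1

theorem StrongDual.le_zero_of_forall_nsmul_le {w z : StrongDual ℝ E} (h : ∀ n : ℕ, n • w ≤ z) :
    w ≤ 0 := fun x hx => by
  refine _root_.le_zero_of_forall_nsmul_le (E := ℝ) (z := z x) fun n => ?_
  simpa using h n x hx

/-- In a Banach lattice with order continuous norm, order bounded disjoint sequences are norm
null. -/
theorem tendsto_norm_of_disjoint_of_le (hE : HasOrderContinuousNorm E) {y : ℕ → E}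
    (h0 : ∀ n, 0 ≤ y n) (hd : Pairwise fun n m => y n ⊓ y m = 0) {x : E} (hx : ∀ n, y n ≤ x) :
    Tendsto (fun n => ‖y n‖) atTop (𝓝 0) := by
  rw [Metric.tendsto_atTop]
  intro ε hε
  have hmono : Monotone fun n => ∑ i ∈ Finset.range n, y i :=
    monotone_nat_of_le_succ fun n => by
      rw [Finset.sum_range_succ]
      exact le_add_of_nonneg_right (h0 n)
  obtain ⟨z, N, hz, hN⟩ := hE.exists_upperBound_norm_sub_lt
    (fun _ _ => le_zero_of_forall_nsmul_le) hmono
    (fun n => sum_le_of_disjoint h0 hd ((h0 0).trans (hx 0)) hx _) hε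
  refine ⟨N, fun n hn => ?_⟩
  -- For `n ≥ N` the term `y n` and the sum up to `N` both occur in the partial sum over `range (n +
  -- 1)`, which is below `z`.
  have hle : y n ≤ z - ∑ i ∈ Finset.range N, y i := by
    have h1 := hz (n + 1)
    rw [Finset.sum_range_succ] at h1
    exact le_sub_iff_add_le'.2 ((add_le_add_left (hmono hn) _).trans h1)
  rw [dist_zero_right, norm_norm]
  refine lt_of_le_of_lt (norm_le_norm_of_abs_le_abs ?_) hN
  rwa [abs_of_nonneg (h0 n), abs_of_nonneg ((h0 n).trans hle)]

/-- If the norm of the dual is order continuous, bounded disjoint sequences of positive elements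
are weakly null. -/
theorem tendsto_apply_of_disjoint (hE : HasOrderContinuousNorm (StrongDual ℝ E)) {x : ℕ → E}
    (h0 : ∀ n, 0 ≤ x n) (hd : Pairwise fun n m => x n ⊓ x m = 0) (h1 : ∀ n, ‖x n‖ ≤ 1)
    (φ : StrongDual ℝ E) : Tendsto (fun n => φ (x n)) atTop (𝓝 0) := by
  suffices hpos : ∀ g : StrongDual ℝ E, 0 ≤ g → Tendsto (fun n => g (x n)) atTop (𝓝 0) by
    obtain ⟨g, h, hg, hh, rfl⟩ := φ.exists_nonneg_sub_nonneg
    simpa using (hpos g hg).sub (hpos h hh)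
  intro g hg
  -- The component `f n` agrees with `g` at `x n`, but unlike constant copies of `g` the `f n` have
  -- partial sums bounded by `g`.
  choose f hf using fun n => exists_isComponent hg (h0 n)
  have hf0 : ∀ n, 0 ≤ f n := fun n => (hf n).nonneg hg (h0 n)
  rw [Metric.tendsto_atTop]
  intro ε hε
  have hmono : Monotone fun n => ∑ i ∈ Finset.range n, f i :=
    monotone_nat_of_le_succ fun n => by
      rw [Finset.sum_range_succ]
      exact le_add_of_nonneg_right (hf0 n)
  obtain ⟨z, N, hz, hN⟩ := hE.exists_upperBound_norm_sub_lt
    (fun _ _ => StrongDual.le_zero_of_forall_nsmul_le) hmono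
    (fun n => sum_component_le hg h0 hd hf _) hε
  refine ⟨N, fun n hn => ?_⟩
  have hle : f n ≤ z - ∑ i ∈ Finset.range N, f i := by
    have h1 := hz (n + 1)
    rw [Finset.sum_range_succ] at h1
    exact le_sub_iff_add_le'.2 ((add_le_add_left (hmono hn) _).trans h1)
  have h2 := hle (x n) (h0 n)
  rw [(hf n).apply_self (h0 n)] at h2
  rw [dist_zero_right, Real.norm_of_nonneg (StrongDual.nonneg_iff.1 hg _ (h0 n))]
  calc g (x n) ≤ ‖(z - ∑ i ∈ Finset.range N, f i) (x n)‖ := h2.trans (le_abs_self _)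
    _ ≤ ‖z - ∑ i ∈ Finset.range N, f i‖ * ‖x n‖ := ContinuousLinearMap.le_opNorm _ _
    _ ≤ ‖z - ∑ i ∈ Finset.range N, f i‖ := mul_le_of_le_one_right (norm_nonneg _) (h1 n)
    _ < ε := hN

/-- If the norm of `E` is order continuous, the components of a bounded sequence of functionals on
a disjoint sequence are weak* null. -/
theorem tendsto_component_apply (hE : HasOrderContinuousNorm E) {x : ℕ → E}
    (h0 : ∀ n, 0 ≤ x n) (hd : Pairwise fun n m => x n ⊓ x m = 0) {g f : ℕ → StrongDual ℝ E}
    (hg : ∀ n, 0 ≤ g n) (hg1 : ∀ n y, 0 ≤ y → g n y ≤ ‖y‖)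
    (hf : ∀ n, IsComponent (g n) (x n) (f n)) (y : E) :
    Tendsto (fun n => f n y) atTop (𝓝 0) := by
  suffices hpos : ∀ y : E, 0 ≤ y → Tendsto (fun n => f n y) atTop (𝓝 0) by
    have h := (hpos _ (posPart_nonneg y)).sub (hpos _ (negPart_nonneg y))
    simpa only [← map_sub, posPart_sub_negPart, sub_zero] using h
  intro y hy
  -- Up to an error `1 / (n + 1)`, `f n y` is the value of `g n` at `y ⊓ t n • x n`. These elements
  -- are disjoint and below `y`, hence norm null.
  have hex : ∀ n : ℕ, ∃ t : ℝ, 0 ≤ t ∧ f n y - 1 / ((n : ℝ) + 1) < g n (y ⊓ t • x n) := fun n => by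
    have hlt : f n y - 1 / ((n : ℝ) + 1) < f n y := sub_lt_self _ (by positivity)
    exact ((eventually_ge_atTop 0).and ((hf n y hy).eventually (lt_mem_nhds hlt))).exists
  choose t ht0 ht using hex
  have hy0 : ∀ n, 0 ≤ y ⊓ t n • x n := fun n => le_inf hy (smul_nonneg (ht0 n) (h0 n))
  have hnull := tendsto_norm_of_disjoint_of_le hE hy0 (fun n m hnm => inf_eq_zero_of_le (hy0 n)
    (hy0 m) inf_le_right inf_le_right (smul_inf_smul_eq_zero (h0 n) (h0 m) (hd hnm) (ht0 n)
      (ht0 m))) fun n => inf_le_left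
  have hsum := hnull.add (tendsto_one_div_add_atTop_nhds_zero_nat (𝕜 := ℝ))
  rw [add_zero] at hsum
  refine squeeze_zero (fun n => (hf n).nonneg (hg n) (h0 n) y hy) (fun n => ?_) hsum
  have h1 := ht n
  have h2 := hg1 n _ (hy0 n)
  linarith

/-! ### Disjoint sequences in infinite dimensional lattices -/

/-- `a` is a nonzero positive element that dominates no two nonzero disjoint positive elements. -/
structure IsVectorAtom (a : E) : Prop where
  nonneg : 0 ≤ a
  ne_zero : a ≠ 0
  eq_zero_or : ∀ v w : E, 0 ≤ v → v ≤ a → 0 ≤ w → w ≤ a → v ⊓ w = 0 → v = 0 ∨ w = 0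

/-- The positive and negative parts of `v - s • a` are disjoint and below `(1 + s) • a`. Rescaled by
`(1 + s)⁻¹` they lie below the atom, so one of them is zero. -/
theorem IsVectorAtom.le_smul_or_smul_le {a : E} (ha : IsVectorAtom a) {v : E} (h0 : 0 ≤ v)
    (hv : v ≤ a) {s : ℝ} (hs : 0 ≤ s) : v ≤ s • a ∨ s • a ≤ v := by
  have hM : (0 : ℝ) < 1 + s := by positivity
  have hp : (v - s • a)⁺ ≤ (1 + s) • a := by
    refine sup_le ?_ (smul_nonneg hM.le ha.nonneg)
    refine (sub_le_self _ (smul_nonneg hs ha.nonneg)).trans (hv.trans ?_)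
    rw [add_smul, one_smul]
    exact le_add_of_nonneg_right (smul_nonneg hs ha.nonneg)
  have hn : (v - s • a)⁻ ≤ (1 + s) • a := by
    refine sup_le ?_ (smul_nonneg hM.le ha.nonneg)
    rw [neg_sub, add_smul, one_smul]
    exact (sub_le_self _ h0).trans (le_add_of_nonneg_left ha.nonneg)
  have hi : 0 ≤ (1 + s)⁻¹ := (inv_pos.2 hM).le
  have hscale : ∀ w : E, w ≤ (1 + s) • a → (1 + s)⁻¹ • w ≤ a := fun w hw => by
    have := smul_le_smul_of_nonneg_left hw hi
    rwa [inv_smul_smul₀ hM.ne'] at this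
  rcases ha.eq_zero_or _ _ (smul_nonneg hi (posPart_nonneg _)) (hscale _ hp)
    (smul_nonneg hi (negPart_nonneg _)) (hscale _ hn)
    (smul_inf_smul_eq_zero (posPart_nonneg _) (negPart_nonneg _) (posPart_inf_negPart_eq_zero _) hi hi)
    with h | h
  · left
    have := (smul_eq_zero_iff_right (inv_pos.2 hM).ne').1 h
    exact sub_nonpos.1 (posPart_eq_zero.1 this)
  · right
    have := (smul_eq_zero_iff_right (inv_pos.2 hM).ne').1 h
    exact sub_nonneg.1 (negPart_eq_zero.1 this)

/-- The multiples of a nonzero positive element below a given positive element have a maximum. -/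
theorem exists_isGreatest_smul_le {a x : E} (ha : 0 ≤ a) (ha0 : a ≠ 0) (hx : 0 ≤ x) :
    ∃ t : ℝ, IsGreatest {t : ℝ | t • a ≤ x} t := by
  have hclosed : IsClosed {t : ℝ | t • a ≤ x} :=
    isClosed_le (continuous_id.smul continuous_const) continuous_const
  have hne : {t : ℝ | t • a ≤ x}.Nonempty := ⟨0, by simpa using hx⟩
  have hbdd : BddAbove {t : ℝ | t • a ≤ x} := by
    refine ⟨‖x‖ / ‖a‖, fun t ht => ?_⟩
    have ha' : 0 < ‖a‖ := norm_pos_iff.2 ha0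
    rcases le_total t 0 with h | h
    · exact h.trans (by positivity)
    · rw [le_div_iff₀ ha']
      have h1 : ‖t • a‖ ≤ ‖x‖ := norm_le_norm_of_abs_le_abs (by
        rw [abs_of_nonneg (smul_nonneg h ha), abs_of_nonneg hx]
        exact ht)
      rwa [norm_smul, Real.norm_of_nonneg h] at h1
  exact ⟨_, hclosed.csSup_mem hne hbdd, fun t ht => le_csSup hbdd ht⟩

/-- Take the greatest `t` with `t • a ≤ v`. Every larger coefficient `s` fails `s • a ≤ v`, so
comparability gives `v ≤ s • a`; let `s` decrease to `t`. -/
theorem IsVectorAtom.exists_eq_smul {a : E} (ha : IsVectorAtom a) {v : E} (h0 : 0 ≤ v)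
    (hv : v ≤ a) : ∃ t : ℝ, 0 ≤ t ∧ v = t • a := by
  obtain ⟨t, ht, hmax⟩ := exists_isGreatest_smul_le ha.nonneg ha.ne_zero h0
  have ht0 : 0 ≤ t := hmax (by simpa using h0)
  refine ⟨t, ht0, le_antisymm ?_ ht⟩
  have hlim : Tendsto (fun n : ℕ => (t + 1 / ((n : ℝ) + 1)) • a) atTop (𝓝 (t • a)) := by
    simpa using ((tendsto_one_div_add_atTop_nhds_zero_nat (𝕜 := ℝ)).const_add t).smul_const a
  refine ge_of_tendsto' hlim fun n => ?_
  have hn : (0 : ℝ) < 1 / ((n : ℝ) + 1) := by positivity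
  rcases ha.le_smul_or_smul_le h0 hv (s := t + 1 / ((n : ℝ) + 1)) (by positivity) with h | h
  · exact h
  · linarith [hmax h]

/-- With `t` greatest such that `t • a ≤ x`, the meet of the remainder with `a` is some `s • a`.
Then `(t + s) • a ≤ x`, and maximality forces `s = 0`. -/
theorem IsVectorAtom.exists_sub_smul_inf_eq_zero {a : E} (ha : IsVectorAtom a) {x : E}
    (hx : 0 ≤ x) : ∃ t : ℝ, 0 ≤ t ∧ 0 ≤ x - t • a ∧ (x - t • a) ⊓ a = 0 := by
  obtain ⟨t, ht, hmax⟩ := exists_isGreatest_smul_le ha.nonneg ha.ne_zero hx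
  have h0 : 0 ≤ x - t • a := sub_nonneg.2 ht
  refine ⟨t, hmax (by simpa using hx), h0, ?_⟩
  obtain ⟨s, hs, hsa⟩ := ha.exists_eq_smul (le_inf h0 ha.nonneg) inf_le_right
  have h1 : (t + s) • a ≤ x := by
    have : s • a ≤ x - t • a := hsa ▸ inf_le_left
    rw [add_smul]
    exact le_sub_iff_add_le'.1 this
  have : s = 0 := le_antisymm (by linarith [hmax h1]) hs
  rw [hsa, this, zero_smul]

/-- Multiples of the atoms are removed one atom at a time; disjointness from the atoms already
treated survives because the remainder only decreases. -/
theorem exists_sub_mem_span_inf_eq_zero (A : Finset E) (hA : ∀ a ∈ A, IsVectorAtom a) {x : E}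
    (hx : 0 ≤ x) : ∃ y, 0 ≤ y ∧ x - y ∈ Submodule.span ℝ (A : Set E) ∧ ∀ a ∈ A, a ⊓ y = 0 := by
  classical
  induction A using Finset.induction_on with
  | empty => exact ⟨x, hx, by simp, by simp⟩
  | insert a A _ ih =>
    obtain ⟨y, hy, hspan, hdisj⟩ := ih fun b hb => hA b (Finset.mem_insert_of_mem hb)
    have ha := hA a (Finset.mem_insert_self a A)
    obtain ⟨t, ht, h0, hinf⟩ := ha.exists_sub_smul_inf_eq_zero hy
    refine ⟨y - t • a, h0, ?_, fun b hb => ?_⟩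
    · rw [← sub_add]
      refine add_mem (Submodule.span_mono (by simp) hspan) (Submodule.smul_mem _ _ ?_)
      exact Submodule.subset_span (by simp)
    · rcases Finset.mem_insert.1 hb with rfl | hb
      · rwa [inf_comm]
      · exact inf_eq_zero_of_le (hA b (Finset.mem_insert_of_mem hb)).nonneg h0 le_rfl
          (sub_le_self _ (smul_nonneg ht ha.nonneg)) (hdisj b hb)

theorem exists_disjoint_seq_of_forall_not_isVectorAtom {u : E} (hu : 0 ≤ u) (hu0 : u ≠ 0)
    (h : ∀ a, a ≤ u → ¬ IsVectorAtom a) :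
    ∃ x : ℕ → E, (∀ n, 0 ≤ x n ∧ x n ≠ 0) ∧ Pairwise fun n m => x n ⊓ x m = 0 := by
  let U := {v : E // 0 ≤ v ∧ v ≠ 0 ∧ v ≤ u}
  have hsplit : ∀ v : U, ∃ p : U × U, p.1.1 ≤ v.1 ∧ p.2.1 ≤ v.1 ∧ p.1.1 ⊓ p.2.1 = 0 := by
    rintro ⟨v, hv, hv0, hvu⟩
    by_contra! hcon
    refine h v hvu ⟨hv, hv0, fun a b ha hav hb hbv hab => ?_⟩
    by_contra! hne
    exact hcon (⟨a, ha, hne.1, hav.trans hvu⟩, ⟨b, hb, hne.2, hbv.trans hvu⟩) hav hbv hab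
  choose p hp1 hp2 hp using hsplit
  -- Each element splits into two nonzero disjoint parts: the first is kept as a term of the
  -- sequence, the second is split again.
  let v : ℕ → U := fun n => (fun w => (p w).2)^[n] ⟨u, hu, hu0, le_rfl⟩
  have hsucc : ∀ n, v (n + 1) = (p (v n)).2 := fun n => Function.iterate_succ_apply' _ _ _
  have hanti : Antitone fun n => (v n).1 := antitone_nat_of_succ_le fun n => by
    rw [hsucc]
    exact hp2 _
  have hlt : ∀ n m, n < m → (p (v n)).1.1 ⊓ (p (v m)).1.1 = 0 := fun n m hnm => by
    refine inf_eq_zero_of_le (p (v n)).1.2.1 (p (v m)).1.2.1 le_rfl ?_ (hp (v n))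
    rw [← hsucc]
    exact (hp1 _).trans (hanti hnm)
  refine ⟨fun n => (p (v n)).1.1, fun n => ⟨(p (v n)).1.2.1, (p (v n)).1.2.2.1⟩,
    fun n m hnm => ?_⟩
  rcases lt_or_gt_of_ne hnm with h1 | h1
  · exact hlt n m h1
  · rw [inf_comm]
    exact hlt m n h1

/-- An infinite dimensional normed lattice contains an infinite disjoint sequence of nonzero
positive elements. -/
theorem exists_disjoint_seq (hE : ¬ FiniteDimensional ℝ E) :
    ∃ x : ℕ → E, (∀ n, 0 ≤ x n ∧ x n ≠ 0) ∧ Pairwise fun n m => x n ⊓ x m = 0 := by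
  by_cases hatom : ∀ u : E, 0 ≤ u → u ≠ 0 → ∃ a, a ≤ u ∧ IsVectorAtom a
  · have : Std.Symm fun a b : E => a ⊓ b = 0 := ⟨fun a b h => by rwa [inf_comm]⟩
    obtain ⟨x, hx, hd⟩ := exists_seq_of_forall_finset_exists' (fun a : E => IsVectorAtom a)
      (fun a b => a ⊓ b = 0) fun A hA => by
        -- Finitely many atoms cannot span all positive elements. A positive `x` outside their span
        -- leaves a nonzero remainder disjoint from them, and an atom below it is the next term.
        have hex : ∃ x : E, 0 ≤ x ∧ x ∉ Submodule.span ℝ (A : Set E) := by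
          by_contra! hcon
          refine hE (Module.finite_def.2 ⟨A, eq_top_iff.2 fun x _ => ?_⟩)
          rw [← posPart_sub_negPart x]
          exact sub_mem (hcon _ (posPart_nonneg x)) (hcon _ (negPart_nonneg x))
        obtain ⟨x, hx, hxA⟩ := hex
        obtain ⟨y, hy, hspan, hdisj⟩ := exists_sub_mem_span_inf_eq_zero A hA hx
        have hy0 : y ≠ 0 := by
          rintro rfl
          exact hxA (by simpa using hspan)
        obtain ⟨a, hay, ha⟩ := hatom y hy hy0
        exact ⟨a, ha, fun b hb => inf_eq_zero_of_le (hA b hb).nonneg ha.nonneg le_rfl hay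
          (hdisj b hb)⟩
    exact ⟨x, fun n => ⟨(hx n).nonneg, (hx n).ne_zero⟩, hd⟩
  · push Not at hatom
    obtain ⟨u, hu, hu0, h⟩ := hatom
    exact exists_disjoint_seq_of_forall_not_isVectorAtom hu hu0 h

theorem exists_normalized_disjoint_seq (hE : ¬ FiniteDimensional ℝ E) :
    ∃ x : ℕ → E, (∀ n, 0 ≤ x n) ∧ (∀ n, ‖x n‖ = 1) ∧ Pairwise fun n m => x n ⊓ x m = 0 := by
  obtain ⟨x, hx, hd⟩ := exists_disjoint_seq hE
  refine ⟨fun n => ‖x n‖⁻¹ • x n, fun n => smul_nonneg (by positivity) (hx n).1, fun n => ?_,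
    fun n m hnm => smul_inf_smul_eq_zero (hx n).1 (hx m).1 (hd hnm) (by positivity)
      (by positivity)⟩
  rw [norm_smul, norm_inv, norm_norm, inv_mul_cancel₀ (norm_ne_zero_iff.2 (hx n).2)]

/-! ### The weak Dunford-Pettis* property -/

theorem HasWDPStarProperty.finiteDimensional (hE : HasWDPStarProperty E)
    (h : HasOrderContinuousNorm E) (h' : HasOrderContinuousNorm (StrongDual ℝ E)) :
    FiniteDimensional ℝ E := by
  by_contra hinf
  obtain ⟨x, hx, hx1, hd⟩ := exists_normalized_disjoint_seq hinf
  choose g hg hgx hg1 using fun n => exists_nonneg_dual_vector (hx n)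
  choose f hf using fun n => exists_isComponent (hg n) (hx n)
  have hnull : Tendsto (fun n => f n (x n)) atTop (𝓝 0) := by
    refine hE x f ?_ (fun n m hnm => ?_) ?_
    -- Weak convergence is tested on functionals; the injectivity required of the pairing is the
    -- separation of points by the dual.
    · refine (WeakBilin.tendsto_iff_forall_eval_tendsto (topDualPairing ℝ E).flip
        (fun y z hyz => (SeparatingDual.eq_iff_forall_dual_eq (R := ℝ)).2
          (LinearMap.congr_fun hyz))).2 fun φ => ?_
      have hφ := tendsto_apply_of_disjoint h' hx hd (fun n => (hx1 n).le) φ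
      rw [← map_zero φ] at hφ
      exact hφ
    · rw [abs_of_nonneg ((hf n).nonneg (hg n) (hx n)), abs_of_nonneg ((hf m).nonneg (hg m) (hx m))]
      exact (hf n).inf_eq_zero (hf m) (hg n) (hg m) (hx n) (hx m) (hd hnm)
    · refine tendsto_iff_forall_eval_tendsto_topDualPairing.2 fun y => ?_
      exact tendsto_component_apply h hx hd hg hg1 hf y
  have hle : (1 : ℝ) ≤ 0 := ge_of_tendsto' hnull fun n => by
    rw [(hf n).apply_self (hx n), ← hx1 n]
    exact hgx n
  exact absurd hle (by norm_num)

/-! ### Reflexive Banach lattices -/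

/-- A decreasing net of positive elements that converges weakly to `0` converges in norm, if the
norm is monotone on the positive elements. -/
theorem tendsto_norm_of_antitone_of_weakly_null {X ι : Type*} [NormedAddCommGroup X]
    [NormedSpace ℝ X] [Lattice X] [IsOrderedAddMonoid X]
    (hsmul : ∀ (c : ℝ) (x y : X), 0 ≤ c → x ≤ y → c • x ≤ c • y)
    (hmono : ∀ x y : X, 0 ≤ x → x ≤ y → ‖x‖ ≤ ‖y‖) [Preorder ι] [IsDirectedOrder ι] [Nonempty ι]
    {x : ι → X} (hx : Antitone x) (h0 : ∀ i, 0 ≤ x i)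
    (hlim : ∀ φ : StrongDual ℝ X, Tendsto (fun i => φ (x i)) atTop (𝓝 0)) :
    Tendsto (fun i => ‖x i‖) atTop (𝓝 0) := by
  -- The net being decreasing and directed, its upward closure is convex, so by Hahn–Banach weak
  -- convergence puts `0` in its norm closure. A small `y` above `x i` then controls every later `x
  -- j`.
  have hconv : Convex ℝ {y : X | ∃ i, x i ≤ y} := by
    rintro y ⟨i, hi⟩ z ⟨j, hj⟩ a b ha hb hab
    obtain ⟨k, hik, hjk⟩ := exists_ge_ge i j
    refine ⟨k, ?_⟩
    calc x k = a • x k + b • x k := by rw [← add_smul, hab, one_smul]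
      _ ≤ a • y + b • z := add_le_add (hsmul a _ _ ha ((hx hik).trans hi))
          (hsmul b _ _ hb ((hx hjk).trans hj))
  have hmem : (0 : X) ∈ closure {y : X | ∃ i, x i ≤ y} := by
    by_contra hnot
    obtain ⟨φ, u, hu, hφ⟩ := geometric_hahn_banach_point_closed hconv.closure isClosed_closure hnot
    rw [map_zero] at hu
    exact absurd (ge_of_tendsto' (hlim φ) fun i => (hφ _ (subset_closure ⟨i, le_rfl⟩)).le) hu.not_ge
  refine Metric.tendsto_nhds.2 fun ε hε => ?_
  obtain ⟨y, ⟨i, hi⟩, hy⟩ := Metric.mem_closure_iff.1 hmem ε hε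
  rw [dist_zero_left] at hy
  filter_upwards [eventually_ge_atTop i] with j hj
  rw [dist_zero_right, norm_norm]
  exact (hmono _ _ (h0 j) ((hx hj).trans hi)).trans_lt hy

theorem norm_le_norm_of_nonneg_of_le {x y : E} (h0 : 0 ≤ x) (h : x ≤ y) : ‖x‖ ≤ ‖y‖ :=
  norm_le_norm_of_abs_le_abs (by rwa [abs_of_nonneg h0, abs_of_nonneg (h0.trans h)])

theorem StrongDual.norm_le_norm_of_nonneg_of_le {f g : StrongDual ℝ E} (h0 : 0 ≤ f) (h : f ≤ g) :
    ‖f‖ ≤ ‖g‖ := by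
  refine f.opNorm_le_bound (norm_nonneg g) fun x => ?_
  have h1 : f x ≤ f |x| := StrongDual.apply_mono h0 (le_abs_self x)
  have h2 : -f x ≤ f |x| := by
    rw [← map_neg]
    exact StrongDual.apply_mono h0 (neg_le_abs x)
  calc ‖f x‖ ≤ f |x| := abs_le'.2 ⟨h1, h2⟩
    _ ≤ g |x| := h _ (abs_nonneg x)
    _ ≤ ‖g |x|‖ := le_abs_self _
    _ ≤ ‖g‖ * ‖x‖ := by
      rw [← norm_abs_eq_norm x]
      exact g.le_opNorm _

/-- Test on the component, carried by `x⁻`, of a functional norming `x⁻`. It kills `x⁺`, so its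
value at `x` is at most `-‖x⁻‖`. -/
theorem nonneg_of_forall_nonneg_dual {x : E} (h : ∀ g : StrongDual ℝ E, 0 ≤ g → 0 ≤ g x) :
    0 ≤ x := by
  obtain ⟨g, hg, hgx, -⟩ := exists_nonneg_dual_vector (negPart_nonneg x)
  obtain ⟨f, hf⟩ := exists_isComponent hg (negPart_nonneg x)
  have h1 := h f (hf.nonneg hg (negPart_nonneg x))
  rw [← posPart_sub_negPart x, map_sub, hf.apply_self (negPart_nonneg x),
    hf.apply_eq_zero (negPart_nonneg x) (posPart_nonneg x) (posPart_inf_negPart_eq_zero x)] at h1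
  have h2 : ‖x⁻‖ = 0 := le_antisymm (by linarith) (norm_nonneg _)
  exact negPart_eq_zero.1 (norm_eq_zero.1 h2)

/-- A decreasing net of positive functionals with infimum `0` converges to `0` pointwise. -/
theorem StrongDual.tendsto_apply_of_isGLB {ι : Type*} [Preorder ι] [IsDirectedOrder ι] [Nonempty ι]
    {f : ι → StrongDual ℝ E} (hf : Antitone f) (hglb : IsGLB (Set.range f) 0) (x : E) :
    Tendsto (fun i => f i x) atTop (𝓝 0) := by
  have h0 : ∀ i, 0 ≤ f i := fun i => hglb.1 ⟨i, rfl⟩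
  have hlim : ∀ x : E, 0 ≤ x → Tendsto (fun i => f i x) atTop (𝓝 (⨅ i, f i x)) := fun x hx =>
    tendsto_atTop_ciInf (fun i j hij => hf hij x hx) ⟨0, by rintro _ ⟨i, rfl⟩; exact h0 i x hx⟩
  have hnonneg : ∀ x : E, 0 ≤ x → 0 ≤ ⨅ i, f i x := fun x hx => le_ciInf fun i => h0 i x hx
  have hle : ∀ i, ∀ x : E, 0 ≤ x → ⨅ i, f i x ≤ f i x := fun i x hx =>
    ciInf_le ⟨0, by rintro _ ⟨i, rfl⟩; exact h0 i x hx⟩ i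
  obtain ⟨i₀⟩ := ‹Nonempty ι›
  -- The pointwise infimum is a limit, hence additive on the cone. Its extension `φ` is a lower
  -- bound of the net, so `φ ≤ 0`.
  obtain ⟨φ, hφ⟩ := exists_strongDual_of_additive (p := fun x => ⨅ i, f i x) (C := ‖f i₀‖)
    (fun x y hx hy => tendsto_nhds_unique (hlim _ (add_nonneg hx hy))
      (by simpa using (hlim x hx).add (hlim y hy))) hnonneg
    (fun x hx => (hle i₀ x hx).trans ((le_abs_self _).trans ((f i₀).le_opNorm x)))
  have hφ0 : φ ≤ 0 := hglb.2 (by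
    rintro _ ⟨i, rfl⟩ x hx
    rw [hφ x hx]
    exact hle i x hx)
  have hpos : ∀ x : E, 0 ≤ x → Tendsto (fun i => f i x) atTop (𝓝 0) := fun x hx => by
    have h1 := hlim x hx
    have h2 := hφ0 x hx
    rw [hφ x hx] at h2
    rwa [le_antisymm h2 (hnonneg x hx)] at h1
  have h := (hpos _ (posPart_nonneg x)).sub (hpos _ (negPart_nonneg x))
  simpa only [← map_sub, posPart_sub_negPart, sub_zero] using h

/-- By reflexivity every functional on the dual is evaluation at a point, so pointwise convergence
is already weak convergence. -/
theorem IsReflexiveSpace.hasOrderContinuousNorm_strongDual (hE : IsReflexiveSpace E) :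
    HasOrderContinuousNorm (StrongDual ℝ E) := fun ι _ _ _ f hf hglb => by
  refine tendsto_norm_of_antitone_of_weakly_null (fun c g h hc hgh x hx => ?_)
    (fun g h => StrongDual.norm_le_norm_of_nonneg_of_le) hf (fun i => hglb.1 ⟨i, rfl⟩) fun Φ => ?_
  · exact mul_le_mul_of_nonneg_left (hgh x hx) hc
  · obtain ⟨x, rfl⟩ := hE Φ
    exact StrongDual.tendsto_apply_of_isGLB hf hglb x

/-- The limits of `φ (x i)` define an element of the bidual, hence by reflexivity a point `z` of
`E`. Positive functionals show that `z ≥ 0` and that `z` is a lower bound of the net, so `z = 0` and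
the net is weakly null. -/
theorem IsReflexiveSpace.hasOrderContinuousNorm (hE : IsReflexiveSpace E) :
    HasOrderContinuousNorm E := fun ι _ _ _ x hx hglb => by
  have h0 : ∀ i, 0 ≤ x i := fun i => hglb.1 ⟨i, rfl⟩
  refine tendsto_norm_of_antitone_of_weakly_null
    (fun c y z hc hyz => smul_le_smul_of_nonneg_left hyz hc)
    (fun y z => norm_le_norm_of_nonneg_of_le) hx h0 ?_
  have hbdd : ∀ g : StrongDual ℝ E, 0 ≤ g → BddBelow (Set.range fun i => g (x i)) := fun g hg =>
    ⟨0, by rintro _ ⟨i, rfl⟩; exact StrongDual.nonneg_iff.1 hg _ (h0 i)⟩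
  have hpos : ∀ g : StrongDual ℝ E, 0 ≤ g → Tendsto (fun i => g (x i)) atTop
      (𝓝 (⨅ i, g (x i))) := fun g hg =>
    tendsto_atTop_ciInf (fun i j hij => StrongDual.apply_mono hg (hx hij)) (hbdd g hg)
  have hex : ∀ φ : StrongDual ℝ E, ∃ L : ℝ, Tendsto (fun i => φ (x i)) atTop (𝓝 L) := fun φ => by
    obtain ⟨g, h, hg, hh, rfl⟩ := φ.exists_nonneg_sub_nonneg
    exact ⟨_, (hpos g hg).sub (hpos h hh)⟩
  choose L hL using hex
  obtain ⟨i₀⟩ := ‹Nonempty ι›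
  let Λ : StrongDual ℝ E →ₗ[ℝ] ℝ :=
    { toFun := L
      map_add' := fun φ ψ => tendsto_nhds_unique (hL _) ((hL φ).add (hL ψ))
      map_smul' := fun c φ => tendsto_nhds_unique (hL _) ((hL φ).const_mul c) }
  -- From `i₀` on, monotonicity of the norm bounds `‖x i‖` by `‖x i₀‖`, which therefore bounds the
  -- limit functional.
  obtain ⟨z, hz⟩ := hE (Λ.mkContinuous ‖x i₀‖ fun φ => by
    refine le_of_tendsto (hL φ).norm ?_
    filter_upwards [eventually_ge_atTop i₀] with i hi
    rw [mul_comm]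
    refine (φ.le_opNorm _).trans ?_
    gcongr
    exact norm_le_norm_of_nonneg_of_le (h0 i) (hx hi))
  have hzL : ∀ φ : StrongDual ℝ E, φ z = L φ := fun φ => congrArg (fun Φ => Φ φ) hz
  have hz0 : z = 0 := by
    refine le_antisymm (hglb.2 ?_) (nonneg_of_forall_nonneg_dual fun g hg => ?_)
    · rintro _ ⟨i, rfl⟩
      refine sub_nonneg.1 (nonneg_of_forall_nonneg_dual fun g hg => ?_)
      rw [map_sub, hzL, tendsto_nhds_unique (hL g) (hpos g hg)]
      exact sub_nonneg.2 (ciInf_le (hbdd g hg) i)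
    · rw [hzL]
      exact ge_of_tendsto' (hL g) fun i => StrongDual.nonneg_iff.1 hg _ (h0 i)
  intro φ
  have h1 := hL φ
  rwa [← hzL, hz0, map_zero] at h1

end BanachLattice

theorem mainTheorem6 {E : Type*} [NormedAddCommGroup E] [NormedSpace ℝ E] [CompleteSpace E]
    [Lattice E] [IsOrderedAddMonoid E] [IsOrderedModule ℝ E] [HasSolidNorm E]
    (hE : HasWDPStarProperty E) :
    (HasOrderContinuousNorm E → HasOrderContinuousNorm (StrongDual ℝ E) →
      FiniteDimensional ℝ E) ∧
    (IsReflexiveSpace E → FiniteDimensional ℝ E) :=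
  ⟨hE.finiteDimensional, fun h =>
    hE.finiteDimensional h.hasOrderContinuousNorm h.hasOrderContinuousNorm_strongDual⟩
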